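/- A rational polygon is the convex hull $P \subset \mathbb{R}^2$ of finitely many rational points, not all contained in a line. By Ehrhart's theorem there are unique periodic functions $c_{P,0}, c_{P,1}, c_{P,2} \colon \mathbb{Z} \to \mathbb{Q}$, with $c_{P,2} \not\equiv 0$, such that $|nP \cap \mathbb{Z}^2| = c_{P,0}(n) + c_{P,1}(n)\, n + c_{P,2}(n)\, n^2$ for all positive integers $n$. The period sequence of $P$ is $(s_0, s_1, s_2)$, where $s_i$ is the minimum period of $c_{P,i}$, that is, the least positive integer $p$ such that $c_{P,i}(n+p) = c_{P,i}(n)$ for all $n \in \mathbb{Z}$. Theorem. Given positive integers $r$ and $s$, there exists a rational polygon $P$ with period sequence $(r, s, 1)$. -/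

import Mathlib

open scoped Pointwise

/-- The lattice `ℤ²` inside the plane `ℝ²`. -/
def integerLattice : Set (Fin 2 → ℝ) :=
  Set.range fun z : Fin 2 → ℤ => fun i => (z i : ℝ)

/-- A rational polygon: the convex hull of finitely many rational points of the plane,
not all contained in a line. -/
def IsRationalPolygon (P : Set (Fin 2 → ℝ)) : Prop :=
  ∃ V : Finset (Fin 2 → ℚ),
    ¬ Collinear ℝ ((fun v : Fin 2 → ℚ => fun i => (v i : ℝ)) '' (V : Set (Fin 2 → ℚ))) ∧
    P = convexHull ℝ ((fun v : Fin 2 → ℚ => fun i => (v i : ℝ)) '' (V : Set (Fin 2 → ℚ)))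

/-- The lattice-point enumerator `n ↦ |nP ∩ ℤ²|`
(the set counted is finite when `P` is bounded). -/
noncomputable def latticePointCount (P : Set (Fin 2 → ℝ)) (n : ℕ) : ℕ :=
  (((n : ℝ) • P) ∩ integerLattice).ncard

/-- `p` is the minimum period of `f`: the least positive integer `p` such that
`f (n + p) = f n` for all integers `n`. -/
def IsMinimumPeriod (f : ℤ → ℚ) (p : ℕ) : Prop :=
  IsLeast {q : ℕ | 0 < q ∧ Function.Periodic f (q : ℤ)} p

/-- `c 0`, `c 1`, `c 2` are the coefficient functions of the Ehrhart quasi-polynomial of `P`. -/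
structure IsEhrhartCoefficients (P : Set (Fin 2 → ℝ)) (c : Fin 3 → ℤ → ℚ) : Prop where
  periodic : ∀ i, ∃ q : ℕ, 0 < q ∧ Function.Periodic (c i) (q : ℤ)
  leading_ne_zero : c 2 ≠ 0
  eval_eq : ∀ n : ℕ, 0 < n →
    c 0 n + c 1 n * (n : ℚ) + c 2 n * (n : ℚ) ^ 2 = (latticePointCount P n : ℚ)

/-- The coefficient functions of the Ehrhart quasi-polynomial are determined by `P`. -/
theorem IsEhrhartCoefficients.unique {P : Set (Fin 2 → ℝ)} {c d : Fin 3 → ℤ → ℚ}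
    (hc : IsEhrhartCoefficients P c) (hd : IsEhrhartCoefficients P d) : c = d := by
  have hper : ∃ L : ℕ, 0 < L ∧
      ∀ i, Function.Periodic (c i) (L : ℤ) ∧ Function.Periodic (d i) (L : ℤ) := by
    choose p hp hcp using hc.periodic
    choose q hq hdq using hd.periodic
    refine ⟨(∏ i, p i) * ∏ i, q i, Nat.mul_pos (Finset.prod_pos fun i _ => hp i)
      (Finset.prod_pos fun i _ => hq i), fun i => ⟨?_, ?_⟩⟩
    · obtain ⟨k, hk⟩ := (Finset.dvd_prod_of_mem p (Finset.mem_univ i)).mul_right (∏ i, q i)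
      rw [hk, mul_comm]; push_cast
      simpa using (hcp i).int_mul k
    · obtain ⟨k, hk⟩ := (Finset.dvd_prod_of_mem q (Finset.mem_univ i)).mul_left (∏ i, p i)
      rw [hk, mul_comm]; push_cast
      simpa using (hdq i).int_mul k
  obtain ⟨L, hL, h⟩ := hper
  have hL' : (L : ℚ) ≠ 0 := by positivity
  -- the three coefficients agree at every positive integer
  have key : ∀ n : ℕ, 0 < n → ∀ i, c i n = d i n := by
    intro n hn
    have e : ∀ k : ℕ, (c 0 n - d 0 n) + (c 1 n - d 1 n) * ((n : ℚ) + k * L)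
        + (c 2 n - d 2 n) * ((n : ℚ) + k * L) ^ 2 = 0 := by
      intro k
      have h1 := hc.eval_eq (n + k * L) (by positivity)
      have h2 := hd.eval_eq (n + k * L) (by positivity)
      have hck : ∀ i, c i ((n : ℤ) + k * L) = c i n := fun i => by
        simpa using (h i).1.int_mul k (n : ℤ)
      have hdk : ∀ i, d i ((n : ℤ) + k * L) = d i n := fun i => by
        simpa using (h i).2.int_mul k (n : ℤ)
      push_cast at h1 h2
      simp only [hck, hdk] at h1 h2
      linear_combination h1 - h2
    have e0 := e 0
    have e1 := e 1
    have e2 := e 2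
    push_cast at e0 e1 e2
    have a2 : c 2 n - d 2 n = 0 := by
      have : (c 2 n - d 2 n) * (2 * (L : ℚ) ^ 2) = 0 := by linear_combination e2 - 2 * e1 + e0
      exact (mul_eq_zero.1 this).resolve_right (by positivity)
    have a1 : c 1 n - d 1 n = 0 := by
      rw [a2] at e0 e1
      have : (c 1 n - d 1 n) * (L : ℚ) = 0 := by linear_combination e1 - e0
      exact (mul_eq_zero.1 this).resolve_right hL'
    have a0 : c 0 n - d 0 n = 0 := by
      rw [a2, a1] at e0
      linear_combination e0
    intro i
    fin_cases i
    · exact sub_eq_zero.1 a0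
    · exact sub_eq_zero.1 a1
    · exact sub_eq_zero.1 a2
  funext i m
  have hm : 0 < m + (m.natAbs + 1 : ℕ) * (L : ℤ) := by
    have h1 : (1 : ℤ) ≤ L := by exact_mod_cast hL
    have h2 : -m ≤ |m| := neg_le_abs m
    push_cast
    nlinarith [abs_nonneg m]
  obtain ⟨n, hn⟩ := Int.eq_ofNat_of_zero_le hm.le
  have h3 := key n (by omega) i
  rw [← hn] at h3
  have h4 := (h i).1.int_mul (m.natAbs + 1 : ℕ) m
  have h5 := (h i).2.int_mul (m.natAbs + 1 : ℕ) m
  simp only [Int.cast_id] at h4 h5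
  rw [← h4, ← h5]
  exact h3

/-- `P` has period sequence `(s 0, s 1, s 2)`: each `s i` is the minimum period of the
coefficient function of `n ^ i` in the Ehrhart quasi-polynomial of `P`. -/
def HasPeriodSequence (P : Set (Fin 2 → ℝ)) (s : Fin 3 → ℕ) : Prop :=
  ∃ c : Fin 3 → ℤ → ℚ, IsEhrhartCoefficients P c ∧ ∀ i, IsMinimumPeriod (c i) (s i)

/-!
The polygon with period sequence `(r, s, 1)` is a pentagon with a horizontal chord joining the
lattice points `(0, 0)` and `(s + 2, 0)`. For `s = 1` the part above the chord degenerates to the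
chord itself.

Above the chord is the trapezoid with top edge from `(s - 1, (s - 1) / s)` to
`(s + 1, (s - 1) / s)`. It comes from the triangle with vertices `(0, 0)`, `(s, 0)`,
`(s - 1, (s - 1) / s)` by cutting along the vertical line through the last vertex and inserting a
rectangle of width `2`. Shearing the right half of that triangle by an integral matrix turns lattice
points into those of a lattice triangle, so its Ehrhart function is a polynomial. The inserted
half-open rectangle contributes `2 n (⌊n (s - 1) / s⌋ + 1)` points, hence a term
`-2 n {-n / s}` that affects only the coefficient of `n` and gives it minimum period `s`.

Below the chord is the triangle with vertices `(0, 0)`, `(s + 2, 0)`, `(s + 2, -1 / r)`. Each of its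
edges lies on a line through a lattice point, so its linear coefficient is constant. Its constant
coefficient is, up to a constant, `j (L (r - j) - 2) / (2 r)` with `L = s + 2` and `j = n mod r`;
since `L ≥ 3` this vanishes only for `j = 0`, so the minimum period is `r`.

In the code `s = d + 1`. The points are counted one column at a time
(`latticePointCount_periodPolygon`). The columns are summed in `sum_range_nat_div` (below the chord)
and `sum_columnTop` (above it), and `periodCoeff_eval` reads off the coefficients.
-/

/-! ### The pentagon -/

/-- The polygon with period sequence `(r, d + 1, 1)`, given by linear inequalities. -/
def periodPolygon (r d : ℕ) : Set (Fin 2 → ℝ) :=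
  {p | 0 ≤ p 0 ∧ p 0 ≤ d + 3 ∧ -p 0 ≤ r * (d + 3) * p 1 ∧ (d + 1) * p 1 ≤ p 0 ∧
    (d + 1) * p 1 ≤ d ∧ (d + 1) * p 1 ≤ (d + 3 - p 0) * d}

/-- The rational points whose convex hull is `periodPolygon r d`. For `d = 0` the second and third
points both lie on the segment from the first to the fourth. -/
def periodVertices (r d : ℕ) : Finset (Fin 2 → ℚ) :=
  {![0, 0], ![(d : ℚ), d / (d + 1)], ![(d : ℚ) + 2, d / (d + 1)], ![(d : ℚ) + 3, 0],
    ![(d : ℚ) + 3, -1 / r]}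

theorem coe_image_periodVertices (r d : ℕ) :
    (fun v : Fin 2 → ℚ => fun i => (v i : ℝ)) '' (periodVertices r d : Set (Fin 2 → ℚ)) =
      {![0, 0], ![(d : ℝ), d / (d + 1)], ![(d : ℝ) + 2, d / (d + 1)], ![(d : ℝ) + 3, 0],
        ![(d : ℝ) + 3, -1 / r]} := by
  simp only [periodVertices, Finset.coe_insert, Finset.coe_singleton, Set.image_insert_eq,
    Set.image_singleton]
  have key : ∀ a b : ℚ, (fun i => ((![a, b] i : ℚ) : ℝ)) = ![(a : ℝ), (b : ℝ)] := by
    intro a b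
    ext i
    fin_cases i <;> rfl
  simp only [key]
  push_cast
  rfl

theorem convex_periodPolygon (r d : ℕ) : Convex ℝ (periodPolygon r d) := by
  intro p hp q hq a b ha hb hab
  obtain ⟨p1, p2, p3, p4, p5, p6⟩ := hp
  obtain ⟨q1, q2, q3, q4, q5, q6⟩ := hq
  obtain rfl : b = 1 - a := by linarith
  simp only [periodPolygon, Set.mem_ofPred_eq, Pi.add_apply, Pi.smul_apply, smul_eq_mul]
  refine ⟨?_, ?_, ?_, ?_, ?_, ?_⟩
  · linear_combination a * p1 + (1 - a) * q1
  · linear_combination a * p2 + (1 - a) * q2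
  · linear_combination a * p3 + (1 - a) * q3
  · linear_combination a * p4 + (1 - a) * q4
  · linear_combination a * p5 + (1 - a) * q5
  · linear_combination a * p6 + (1 - a) * q6

/-- A point between two points of a convex set in the same vertical line lies in the set. -/
theorem Convex.mem_of_vertical {C : Set (Fin 2 → ℝ)} (hC : Convex ℝ C) {x a b y : ℝ}
    (ha : ![x, a] ∈ C) (hb : ![x, b] ∈ C) (hay : a ≤ y) (hyb : y ≤ b) : ![x, y] ∈ C := by
  have hy : y ∈ segment ℝ a b := by rw [segment_eq_Icc (hay.trans hyb)]; exact ⟨hay, hyb⟩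
  obtain ⟨α, β, hα, hβ, hαβ, rfl⟩ := hy
  convert hC ha hb hα hβ hαβ using 1
  ext i
  fin_cases i
  · simp [← add_mul, hαβ]
  · simp

/-- A point on the line through two points of a convex set, with abscissa between theirs, lies in
the set. -/
theorem Convex.mem_of_chord {C : Set (Fin 2 → ℝ)} (hC : Convex ℝ C) {x₁ y₁ x₂ y₂ x y : ℝ}
    (h₁ : ![x₁, y₁] ∈ C) (h₂ : ![x₂, y₂] ∈ C) (hlt : x₁ < x₂) (hx₁ : x₁ ≤ x) (hx₂ : x ≤ x₂)
    (hy : (x₂ - x₁) * y = (x₂ - x) * y₁ + (x - x₁) * y₂) : ![x, y] ∈ C := by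
  have hpos : 0 < x₂ - x₁ := sub_pos.2 hlt
  convert hC h₁ h₂ (div_nonneg (sub_nonneg.2 hx₂) hpos.le)
    (div_nonneg (sub_nonneg.2 hx₁) hpos.le) (by field_simp; ring) using 1
  ext i
  fin_cases i
  · simp; field_simp; ring
  · simp; field_simp; linarith

theorem convexHull_periodVertices {r : ℕ} (hr : 0 < r) (d : ℕ) :
    convexHull ℝ ((fun v : Fin 2 → ℚ => fun i => (v i : ℝ)) ''
      (periodVertices r d : Set (Fin 2 → ℚ))) = periodPolygon r d := by
  rw [coe_image_periodVertices]
  have hr' : (0 : ℝ) < r := by exact_mod_cast hr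
  have hd : (0 : ℝ) ≤ d := d.cast_nonneg
  have hd1 : (0 : ℝ) < d + 1 := by positivity
  apply subset_antisymm
  · refine convexHull_min ?_ (convex_periodPolygon r d)
    have e : ((d : ℝ) + 1) * (d / (d + 1)) = d := by field_simp
    have e' : (r : ℝ) * (d + 3) * (-1 / r) = -(d + 3) := by field_simp
    have e'' : ((d : ℝ) + 1) * (-1 / r) ≤ 0 :=
      mul_nonpos_of_nonneg_of_nonpos hd1.le (div_nonpos_of_nonpos_of_nonneg (by simp) hr'.le)
    have e3 : 0 ≤ (r : ℝ) * (d + 3) * (d / (d + 1)) := by positivity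
    rintro p (rfl | rfl | rfl | rfl | rfl) <;> simp [periodPolygon, e, e'] <;>
      (try refine ⟨?_, ?_⟩) <;> (try refine ⟨?_, ?_⟩) <;> (try refine ⟨?_, ?_⟩) <;>
      first | positivity | nlinarith
  · rintro p ⟨h1, h2, h3, h4, h5, h6⟩
    obtain ⟨x, y, rfl⟩ : ∃ x y, p = ![x, y] := ⟨p 0, p 1, by ext i; fin_cases i <;> rfl⟩
    simp only [Matrix.cons_val_zero, Matrix.cons_val_one] at h1 h2 h3 h4 h5 h6
    set S : Set (Fin 2 → ℝ) := {![0, 0], ![(d : ℝ), d / (d + 1)], ![(d : ℝ) + 2, d / (d + 1)],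
      ![(d : ℝ) + 3, 0], ![(d : ℝ) + 3, -1 / r]} with hS
    have hC : Convex ℝ (convexHull ℝ S) := convex_convexHull ℝ S
    have v0 : ![0, 0] ∈ convexHull ℝ S := subset_convexHull ℝ S (by simp [hS])
    have v1 : ![(d : ℝ), d / (d + 1)] ∈ convexHull ℝ S := subset_convexHull ℝ S (by simp [hS])
    have v2 : ![(d : ℝ) + 2, d / (d + 1)] ∈ convexHull ℝ S := subset_convexHull ℝ S (by simp [hS])
    have v3 : ![(d : ℝ) + 3, 0] ∈ convexHull ℝ S := subset_convexHull ℝ S (by simp [hS])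
    have v4 : ![(d : ℝ) + 3, -1 / r] ∈ convexHull ℝ S := subset_convexHull ℝ S (by simp [hS])
    have hbot : ![x, -x / (r * (d + 3))] ∈ convexHull ℝ S :=
      hC.mem_of_chord v0 v4 (by positivity) h1 h2 (by field_simp; ring)
    have hlow : -x / (r * (d + 3)) ≤ y := by
      rw [div_le_iff₀ (by positivity)]; linarith
    -- it remains to find a point of the hull above `(x, y)`, on the edge over the abscissa `x`
    suffices ∃ b, y ≤ b ∧ ![x, b] ∈ convexHull ℝ S by
      obtain ⟨b, hb, hmem⟩ := this
      exact hC.mem_of_vertical hbot hmem hlow hb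
    rcases le_total x d with hxd | hxd
    · refine ⟨x / (d + 1), by rw [le_div_iff₀ hd1]; linarith, ?_⟩
      rcases hd.eq_or_lt with h0 | h0
      · obtain rfl : x = 0 := by linarith
        simpa using v0
      · exact hC.mem_of_chord v0 v1 h0 h1 hxd (by field_simp; ring)
    rcases le_total x (d + 2) with hxd2 | hxd2
    · exact ⟨d / (d + 1), by rw [le_div_iff₀ hd1]; linarith,
        hC.mem_of_chord v1 v2 (by linarith) hxd hxd2 (by ring)⟩
    · exact ⟨(d + 3 - x) * d / (d + 1), by rw [le_div_iff₀ hd1]; linarith,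
        hC.mem_of_chord v2 v3 (by linarith) hxd2 h2 (by field_simp; ring)⟩

theorem isRationalPolygon_periodPolygon {r : ℕ} (hr : 0 < r) (d : ℕ) :
    IsRationalPolygon (periodPolygon r d) := by
  refine ⟨periodVertices r d, ?_, (convexHull_periodVertices hr d).symm⟩
  rw [coe_image_periodVertices,
    collinear_iff_of_mem (p₀ := ![0, 0]) (by simp)]
  rintro ⟨v, hv⟩
  obtain ⟨a, ha⟩ := hv ![(d : ℝ) + 3, 0] (by simp)
  obtain ⟨b, hb⟩ := hv ![(d : ℝ) + 3, -1 / r] (by simp)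
  have a0 := congrFun ha 0
  have a1 := congrFun ha 1
  have b1 := congrFun hb 1
  simp at a0 a1 b1
  rcases a1 with rfl | h
  · have : (0 : ℝ) ≤ d := d.cast_nonneg
    linarith
  · simp [h] at b1
    omega

/-! ### Lattice points in dilates -/

/-- Membership in the `n`-th dilate, for a lattice point. -/
theorem intCast_mem_smul_periodPolygon {r d n : ℕ} (hn : 0 < n) (z : Fin 2 → ℤ) :
    (fun i => (z i : ℝ)) ∈ (n : ℝ) • periodPolygon r d ↔
      0 ≤ z 0 ∧ z 0 ≤ n * (d + 3) ∧ -z 0 ≤ z 1 * (r * (d + 3)) ∧ z 1 * (d + 1) ≤ z 0 ∧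
        z 1 * (d + 1) ≤ n * d ∧ z 1 * (d + 1) ≤ (n * (d + 3) - z 0) * d := by
  have hn' : (0 : ℝ) < n := by exact_mod_cast hn
  rw [Set.mem_smul_set_iff_inv_smul_mem₀ hn'.ne']
  simp only [periodPolygon, Set.mem_ofPred_eq, Pi.smul_apply, smul_eq_mul]
  generalize z 0 = x
  generalize z 1 = y
  have key : ∀ (a b : ℝ) (A B : ℤ), (A : ℝ) = n * a → (B : ℝ) = n * b → (a ≤ b ↔ A ≤ B) := by
    intro a b A B hA hB
    rw [← Int.cast_le (R := ℝ), hA, hB, mul_le_mul_iff_of_pos_left hn']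
  refine and_congr (key _ _ _ _ (by simp) (by field_simp)) <| and_congr (key _ _ _ _ ?_ ?_) <|
    and_congr (key _ _ _ _ ?_ ?_) <| and_congr (key _ _ _ _ ?_ ?_) <|
    and_congr (key _ _ _ _ ?_ ?_) (key _ _ _ _ ?_ ?_) <;> push_cast <;> field_simp

/-- The largest ordinate of a lattice point with abscissa `u` in the `n`-th dilate. -/
def columnTop (d n u : ℕ) : ℤ :=
  min (min ((u : ℤ) / (d + 1)) ((n * d : ℤ) / (d + 1))) ((n * (d + 3) - u : ℤ) * d / (d + 1))

theorem columnTop_nonneg {d n u : ℕ} (hu : u < n * (d + 3) + 1) : 0 ≤ columnTop d n u := by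
  have : (u : ℤ) ≤ n * (d + 3) := by exact_mod_cast Nat.lt_succ_iff.1 hu
  refine le_min (le_min ?_ ?_) ?_ <;> refine Int.ediv_nonneg ?_ (by positivity)
  · positivity
  · positivity
  · exact mul_nonneg (by linarith) (by positivity)

theorem latticePointCount_periodPolygon {r n : ℕ} (hr : 0 < r) (d : ℕ) (hn : 0 < n) :
    (latticePointCount (periodPolygon r d) n : ℤ) =
      ∑ u ∈ Finset.range (n * (d + 3) + 1), (columnTop d n u + (u / (r * (d + 3)) : ℕ) + 1) := by
  have hk : (0 : ℤ) < r * (d + 3) := by positivity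
  have hd : (0 : ℤ) < d + 1 := by positivity
  let F : Finset (Σ _ : ℕ, ℤ) := (Finset.range (n * (d + 3) + 1)).sigma fun u =>
    Finset.Icc (-((u / (r * (d + 3)) : ℕ) : ℤ)) (columnTop d n u)
  let φ : (Σ _ : ℕ, ℤ) → (Fin 2 → ℝ) := fun p => ![(p.1 : ℝ), (p.2 : ℝ)]
  have hφ : Function.Injective φ := by
    rintro ⟨u, y⟩ ⟨u', y'⟩ h
    have h0 := congrFun h 0
    have h1 := congrFun h 1
    simp [φ] at h0 h1
    subst h0 h1
    rfl
  have hset : ((n : ℝ) • periodPolygon r d) ∩ integerLattice = φ '' (F : Set (Σ _ : ℕ, ℤ)) := by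
    -- the inequalities cutting out a column, in terms of the floor functions
    have hcol : ∀ (u : ℕ) (y : ℤ), (-(u : ℤ) ≤ y * (r * (d + 3)) ∧ y * (d + 1) ≤ u ∧
        y * (d + 1) ≤ n * d ∧ y * (d + 1) ≤ (n * (d + 3) - u) * d) ↔
        -((u / (r * (d + 3)) : ℕ) : ℤ) ≤ y ∧ y ≤ columnTop d n u := by
      intro u y
      have hbot : -((u / (r * (d + 3)) : ℕ) : ℤ) ≤ y ↔ -(u : ℤ) ≤ y * (r * (d + 3)) := by
        rw [neg_le]
        push_cast
        rw [Int.le_ediv_iff_mul_le hk, neg_mul, neg_le]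
      rw [columnTop, le_min_iff, le_min_iff, Int.le_ediv_iff_mul_le hd, Int.le_ediv_iff_mul_le hd,
        Int.le_ediv_iff_mul_le hd, hbot, and_assoc]
    ext p
    constructor
    · rintro ⟨hp, z, rfl⟩
      obtain ⟨h1, h2, h3⟩ := (intCast_mem_smul_periodPolygon hn z).1 hp
      obtain ⟨u, hu⟩ := Int.eq_ofNat_of_zero_le h1
      rw [hu] at h2 h3
      refine ⟨⟨u, z 1⟩, ?_, ?_⟩
      · simp only [F, Finset.coe_sigma, Set.mem_sigma_iff, Finset.mem_coe, Finset.mem_range,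
          Finset.mem_Icc]
        exact ⟨Nat.lt_succ_iff.2 (by exact_mod_cast h2), (hcol u (z 1)).1 h3⟩
      · ext i
        fin_cases i <;> simp [φ, hu]
    · rintro ⟨⟨u, y⟩, hF, rfl⟩
      simp only [F, Finset.coe_sigma, Set.mem_sigma_iff, Finset.mem_coe, Finset.mem_range,
        Finset.mem_Icc] at hF
      have hz : φ ⟨u, y⟩ = fun i => ((![(u : ℤ), y] i : ℤ) : ℝ) := by
        ext i
        fin_cases i <;> simp [φ]
      rw [hz]
      refine ⟨(intCast_mem_smul_periodPolygon hn _).2 ?_, _, rfl⟩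
      exact ⟨Int.natCast_nonneg u, by simpa using (by exact_mod_cast Nat.lt_succ_iff.1 hF.1),
        (hcol u y).2 hF.2⟩
  rw [latticePointCount, hset, Set.ncard_image_of_injective _ hφ, Set.ncard_coe_finset,
    Finset.card_sigma]
  push_cast
  refine Finset.sum_congr rfl fun u hu => ?_
  have := columnTop_nonneg (Finset.mem_range.1 hu)
  have h0 : (0 : ℤ) ≤ (u / (r * (d + 3)) : ℕ) := Int.natCast_nonneg _
  push_cast at h0
  rw [Int.card_Icc, Int.toNat_of_nonneg (by linarith)]
  ring

/-- The sum of the first `k * q + j` values of `u ↦ ⌊u / k⌋`. -/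
theorem sum_range_nat_div {k j : ℕ} (hk : 0 < k) (hj : j ≤ k) (q : ℕ) :
    ∑ u ∈ Finset.range (k * q + j), ((u / k : ℕ) : ℚ) = k * q * (q - 1) / 2 + q * j := by
  have block : ∀ q j : ℕ, j ≤ k → ∑ i ∈ Finset.range j, (((k * q + i) / k : ℕ) : ℚ) = q * j := by
    intro q j hj
    rw [Finset.sum_congr rfl (g := fun _ => (q : ℚ))]
    · simp [mul_comm]
    · intro i hi
      rw [Nat.mul_add_div hk, Nat.div_eq_of_lt ((Finset.mem_range.1 hi).trans_le hj), add_zero]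
  rw [Finset.sum_range_add, block q j hj]
  congr 1
  induction q with
  | zero => simp
  | succ q ih =>
    rw [Nat.mul_succ, Finset.sum_range_add, ih, block q k le_rfl]
    push_cast
    ring

/-- The sum of the heights of the columns above the axis. Removing the `2 n` columns over the top
edge and shearing the last `n + 1` columns turns it into a sum over a lattice triangle, which is why
the fractional part of `n / (d + 1)` only enters in the coefficient of `n`. -/
theorem sum_columnTop (d n : ℕ) :
    ∑ u ∈ Finset.range (n * (d + 3) + 1), (columnTop d n u : ℚ) =
      (d + 1) * n * (n - 1) / 2 + n - n * (n + 1) / 2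
        + 2 * n * ((n * d : ℕ) / (d + 1) : ℕ) := by
  have hd : (0 : ℤ) < d + 1 := by positivity
  have hd0 : (0 : ℤ) ≤ d := by positivity
  have hn0 : (0 : ℤ) ≤ n := by positivity
  have left : ∀ u ∈ Finset.range (n * d), (columnTop d n u : ℚ) = ((u / (d + 1) : ℕ) : ℚ) := by
    intro u hu
    have hu : (u : ℤ) ≤ n * d := by exact_mod_cast (Finset.mem_range.1 hu).le
    have : columnTop d n u = ((u / (d + 1) : ℕ) : ℤ) := by
      rw [columnTop, min_eq_left (Int.ediv_le_ediv hd hu), min_eq_left]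
      · push_cast; rfl
      · exact Int.ediv_le_ediv hd (by nlinarith [mul_nonneg hn0 hd0])
    rw [this, Int.cast_natCast]
  have middle : ∀ v ∈ Finset.range (2 * n),
      (columnTop d n (n * d + v) : ℚ) = ((n * d / (d + 1) : ℕ) : ℚ) := by
    intro v hv
    have hv : (v : ℤ) ≤ 2 * n := by exact_mod_cast (Finset.mem_range.1 hv).le
    have : columnTop d n (n * d + v) = ((n * d / (d + 1) : ℕ) : ℤ) := by
      rw [columnTop, min_eq_right (Int.ediv_le_ediv hd (by push_cast; linarith)), min_eq_left]
      · push_cast; rfl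
      · exact Int.ediv_le_ediv hd (by push_cast; nlinarith [mul_nonneg hn0 hd0])
    rw [this, Int.cast_natCast]
  have right : ∀ v ∈ Finset.range (n + 1), (columnTop d n (n * d + 2 * n + v) : ℚ) =
      (((n * d + v) / (d + 1) : ℕ) : ℚ) - v := by
    intro v hv
    have hv : (v : ℤ) ≤ n := by exact_mod_cast Nat.lt_succ_iff.1 (Finset.mem_range.1 hv)
    have hv0 : (0 : ℤ) ≤ v := by positivity
    have : columnTop d n (n * d + 2 * n + v) = (((n * d + v) / (d + 1) : ℕ) : ℤ) - v := by
      rw [columnTop, min_eq_right (Int.ediv_le_ediv hd (by push_cast; linarith)), min_eq_right]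
      · push_cast
        rw [eq_sub_iff_add_eq, ← Int.add_mul_ediv_right _ _ hd.ne']
        congr 1
        ring
      · exact Int.ediv_le_ediv hd (by push_cast; nlinarith [mul_nonneg hv0 hd0])
    rw [this, Int.cast_sub, Int.cast_natCast, Int.cast_natCast]
  have hlen : n * (d + 3) + 1 = n * d + 2 * n + (n + 1) := by ring
  have htri := sum_range_nat_div (k := d + 1) (j := 1) d.succ_pos (by omega) n
  rw [show (d + 1) * n + 1 = n * d + (n + 1) by ring, Finset.sum_range_add] at htri
  have hgauss : ∑ v ∈ Finset.range (n + 1), (v : ℚ) = n * (n + 1) / 2 := by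
    have := Finset.sum_range_id_mul_two (n + 1)
    rw [Nat.add_sub_cancel] at this
    have : (∑ v ∈ Finset.range (n + 1), (v : ℚ)) * 2 = (n + 1) * n := by
      rw [← Nat.cast_sum]
      exact_mod_cast this
    linarith
  rw [hlen, Finset.sum_range_add, Finset.sum_range_add, Finset.sum_congr rfl left,
    Finset.sum_congr rfl middle, Finset.sum_congr rfl right, Finset.sum_sub_distrib, hgauss,
    Finset.sum_const, Finset.card_range, nsmul_eq_mul]
  push_cast at htri ⊢
  linarith

/-! ### The coefficient functions and their periods -/

/-- The Ehrhart coefficients of `periodPolygon r d`. -/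
def periodCoeff (r d : ℕ) : Fin 3 → ℤ → ℚ :=
  ![fun n => 1 + (n % r : ℤ) * ((d + 3) * (r - (n % r : ℤ)) - 2) / (2 * r),
    fun n => (d + 3) / 2 + 1 / r - d / 2 - 2 * ((-n) % (d + 1 : ℕ) : ℤ) / (d + 1),
    fun _ => (d + 3) / (2 * r) + d / 2 + 2 * d / (d + 1)]

theorem periodCoeff_eval {r n : ℕ} (hr : 0 < r) (d : ℕ) (hn : 0 < n) :
    periodCoeff r d 0 n + periodCoeff r d 1 n * (n : ℚ) + periodCoeff r d 2 n * (n : ℚ) ^ 2 =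
      (latticePointCount (periodPolygon r d) n : ℚ) := by
  have hr' : (r : ℚ) ≠ 0 := by positivity
  have hd' : (d + 1 : ℚ) ≠ 0 := by positivity
  have hcount : (latticePointCount (periodPolygon r d) n : ℚ) =
      ∑ u ∈ Finset.range (n * (d + 3) + 1),
        ((columnTop d n u : ℚ) + ((u / (r * (d + 3)) : ℕ) : ℚ) + 1) := by
    have h := congrArg (Int.cast (R := ℚ)) (latticePointCount_periodPolygon hr d hn)
    simpa only [Int.cast_sum, Int.cast_add, Int.cast_natCast, Int.cast_one] using h
  -- Euclidean division of `n` by `r`, and of `n * d` by `d + 1`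
  obtain ⟨q, j, hj, hq⟩ : ∃ q j : ℕ, j < r ∧ n = r * q + j :=
    ⟨n / r, n % r, Nat.mod_lt _ hr, (Nat.div_add_mod n r).symm⟩
  have hbot := sum_range_nat_div (k := r * (d + 3)) (j := j * (d + 3) + 1) (by positivity)
    (by nlinarith) q
  rw [show r * (d + 3) * q + (j * (d + 3) + 1) = n * (d + 3) + 1 by rw [hq]; ring] at hbot
  have hjmod : ((n : ℤ) % r : ℤ) = j := by
    rw [hq]; push_cast
    rw [Int.mul_add_emod_self_left]
    exact Int.emod_eq_of_lt (by positivity) (by exact_mod_cast hj)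
  have hmod : ((-(n : ℤ)) % (d + 1 : ℕ) : ℤ) = ((n * d % (d + 1) : ℕ) : ℤ) := by
    push_cast
    rw [show (n : ℤ) * d = -n + n * (d + 1) by ring, Int.add_mul_emod_self_right]
  have hdiv : ((d : ℚ) + 1) * ((n * d / (d + 1) : ℕ) : ℚ) + ((n * d % (d + 1) : ℕ) : ℚ) = n * d := by
    exact_mod_cast Nat.div_add_mod (n * d) (d + 1)
  have hnq : (n : ℚ) = r * q + j := by exact_mod_cast hq
  rw [hcount, Finset.sum_add_distrib, Finset.sum_add_distrib, sum_columnTop, hbot]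
  simp only [periodCoeff, Matrix.cons_val_zero, Matrix.cons_val_one, Matrix.cons_val, hjmod, hmod,
    Finset.sum_const, Finset.card_range, nsmul_eq_mul, Int.cast_natCast]
  have hdiv' : ((n * d / (d + 1) : ℕ) : ℚ) = (n * d - ((n * d % (d + 1) : ℕ) : ℚ)) / (d + 1) := by
    rw [eq_div_iff hd']; linarith
  have hq' : (q : ℚ) = (n - j) / r := by
    rw [eq_div_iff hr']; linarith
  rw [hdiv', hq']
  generalize ((n * d % (d + 1) : ℕ) : ℚ) = i
  push_cast
  field_simp
  ring

theorem isMinimumPeriod_periodCoeff_zero {r : ℕ} (hr : 0 < r) (d : ℕ) :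
    IsMinimumPeriod (periodCoeff r d 0) r := by
  refine ⟨⟨hr, fun n => by simp [periodCoeff]⟩, fun q ⟨hq, hper⟩ => ?_⟩
  have h := hper 0
  have hlt : (q : ℤ) % r < r := Int.emod_lt_of_pos _ (by exact_mod_cast hr)
  have hlt' : (((q : ℤ) % r : ℤ) : ℚ) + 1 ≤ r := by exact_mod_cast hlt
  have hd : (0 : ℚ) ≤ d := d.cast_nonneg
  have hr' : (r : ℚ) ≠ 0 := by positivity
  simp only [periodCoeff, Matrix.cons_val_zero, zero_add, Int.zero_emod, Int.cast_zero, zero_mul,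
    zero_div, add_zero, add_eq_left, div_eq_zero_iff, mul_eq_zero, hr', or_false, OfNat.ofNat_ne_zero] at h
  -- the second factor is at least `d + 1`, since `q % r ≤ r - 1`
  have h0 : (q : ℤ) % r = 0 := by
    rcases h with h | h
    · exact_mod_cast h
    · nlinarith
  exact Nat.le_of_dvd hq (by exact_mod_cast Int.dvd_of_emod_eq_zero h0)

theorem isMinimumPeriod_periodCoeff_one (r d : ℕ) :
    IsMinimumPeriod (periodCoeff r d 1) (d + 1) := by
  have hd : (d + 1 : ℚ) ≠ 0 := by positivity
  refine ⟨⟨d.succ_pos, fun n => ?_⟩, fun q ⟨hq, hper⟩ => ?_⟩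
  · have : (-(n + (d + 1 : ℕ)) : ℤ) % (d + 1 : ℕ) = -n % (d + 1 : ℕ) := by
      rw [neg_add, ← sub_eq_add_neg, Int.sub_emod_right]
    simp only [periodCoeff, Matrix.cons_val_one, Matrix.cons_val_zero, this]
  · have h := hper 0
    simp only [periodCoeff, Matrix.cons_val_one, Matrix.cons_val_zero, zero_add, neg_zero,
      Int.zero_emod, Int.cast_zero, mul_zero, zero_div, sub_zero, sub_eq_self, div_eq_zero_iff,
      mul_eq_zero, hd, or_false, OfNat.ofNat_ne_zero, false_or, Int.cast_eq_zero] at h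
    have h' := Int.dvd_of_emod_eq_zero h
    rw [dvd_neg] at h'
    exact Nat.le_of_dvd hq (by exact_mod_cast h')

theorem isMinimumPeriod_periodCoeff_two (r d : ℕ) : IsMinimumPeriod (periodCoeff r d 2) 1 :=
  ⟨⟨one_pos, fun _ => rfl⟩, fun _ hq => hq.1⟩

theorem isEhrhartCoefficients_periodCoeff {r : ℕ} (hr : 0 < r) (d : ℕ) :
    IsEhrhartCoefficients (periodPolygon r d) (periodCoeff r d) where
  periodic i := by
    fin_cases i
    · exact ⟨_, (isMinimumPeriod_periodCoeff_zero hr d).1⟩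
    · exact ⟨_, (isMinimumPeriod_periodCoeff_one r d).1⟩
    · exact ⟨_, (isMinimumPeriod_periodCoeff_two r d).1⟩
  leading_ne_zero h := by
    have h0 : (d + 3 : ℚ) / (2 * r) + d / 2 + 2 * d / (d + 1) = 0 := congrFun h 0
    have : (0 : ℚ) < (d + 3 : ℚ) / (2 * r) + d / 2 + 2 * d / (d + 1) := by positivity
    exact this.ne' h0
  eval_eq _ hn := periodCoeff_eval hr d hn

theorem theorem4 (r s : ℕ) (hr : 0 < r) (hs : 0 < s) :
    ∃ P : Set (Fin 2 → ℝ), IsRationalPolygon P ∧ HasPeriodSequence P ![r, s, 1] := by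
  obtain ⟨d, rfl⟩ : ∃ d, s = d + 1 := ⟨s - 1, by omega⟩
  refine ⟨periodPolygon r d, isRationalPolygon_periodPolygon hr d, periodCoeff r d,
    isEhrhartCoefficients_periodCoeff hr d, fun i => ?_⟩
  fin_cases i
  · exact isMinimumPeriod_periodCoeff_zero hr d
  · exact isMinimumPeriod_periodCoeff_one r d
  · exact isMinimumPeriod_periodCoeff_two r d
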